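/- Let $X$ be a finite-dimensional real normed space. Let $\mathrm{Iso}(X)$ be the group of isometries of $X$ (all of them affine, by the Mazur--Ulam theorem), with the topology and smooth structure it has as a closed submanifold of the space $A(X)$ of affine maps $X \to X$. A placement of a set $S$ in $X$ is a point $p = (p_v)_{v \in S} \in X^S$; it is spanning if $\{p_v : v \in S\}$ affinely spans $X$. For $g \in \mathrm{Iso}(X)$ put $g.p := (g(p_v))_{v \in S}$, let $\mathcal{O}_p := \{g.p : g \in \mathrm{Iso}(X)\} \subseteq X^S$ be the orbit of $p$, with its smooth structure as a submanifold of $X^S$ (for infinite $S$: the structure obtained by identifying $\mathcal{O}_p$, through restriction, with the orbit of $p|_T$, where $T \subseteq S$ is a finite subset such that $\{p_v : v\in T\}$ has the same affine span as $\{p_v : v \in S\}$), and let $\phi_p : \mathrm{Iso}(X) \to \mathcal{O}_p$, $g \mapsto g.p$. The placement $p$ is isometrically full if $\phi_p$ is a smooth diffeomorphism. Leave out the placement of the empty set in the zero space. Then all isometrically full placements in $X$ are spanning if and only if $X$ is Euclidean, i.e. its norm is generated by an inner product. -/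

import Mathlib

open scoped ContDiff

universe u v w

/-- `X` is Euclidean: its norm is generated by an inner product on the real vector space `X`. -/
def IsEuclideanNormed (X : Type u) [NormedAddCommGroup X] [NormedSpace ℝ X] : Prop :=
  ∃ c : InnerProductSpace.Core ℝ X, ∀ x : X, ‖x‖ ^ 2 = c.inner x x

/-- A placement `p` of `S` in `X` is spanning if its points affinely span `X`. -/
def IsSpanningPlacement {X : Type u} [NormedAddCommGroup X] [NormedSpace ℝ X] {S : Type v}
    (p : S → X) : Prop :=
  affineSpan ℝ (Set.range p) = ⊤

/-- The inclusion of `Iso(X)`, the group of all surjective isometries of `X`, in the normed space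
`A(X)` of affine maps of `X` (isometries are affine by the Mazur-Ulam theorem). The topology and
the smooth structure of `Iso(X)` are those it has as a subset of `A(X)`. -/
noncomputable def isoToAffine {X : Type u} [NormedAddCommGroup X] [NormedSpace ℝ X]
    (g : X ≃ᵢ X) : X →ᴬ[ℝ] X :=
  g.toRealAffineIsometryEquiv.toContinuousAffineEquiv.toContinuousAffineMap

/-- The action of isometries on placements: `g.p = (g (p v))` for `v` in `S`. -/
def isoAct {X : Type u} [NormedAddCommGroup X] {S : Type v} (g : X ≃ᵢ X) (p : S → X) : S → X :=
  fun s => g (p s)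

/-- The orbit of the placement `p` under `Iso(X)`, a subset of `X ^ S`. -/
def placementOrbit {X : Type u} [NormedAddCommGroup X] {S : Type v} (p : S → X) :
    Set (S → X) :=
  Set.range fun g : X ≃ᵢ X => isoAct g p

/-- The map `φ_p` from `Iso(X)` to the orbit of `p`, given by `g ↦ g.p`. -/
def orbitMap {X : Type u} [NormedAddCommGroup X] {S : Type v} (p : S → X) (g : X ≃ᵢ X) :
    placementOrbit p :=
  ⟨isoAct g p, g, rfl⟩

/-- Smoothness of a map from `Iso(X)`, as a submanifold of `A(X)`, to a normed space: near every
point of `Iso(X)` the map extends to a smooth map on an open subset of `A(X)`. -/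
def IsSmoothOnIso {X : Type u} [NormedAddCommGroup X] [NormedSpace ℝ X]
    {W : Type w} [NormedAddCommGroup W] [NormedSpace ℝ W] (f : (X ≃ᵢ X) → W) : Prop :=
  ∀ g : X ≃ᵢ X, ∃ U : Set (X →ᴬ[ℝ] X), IsOpen U ∧ isoToAffine g ∈ U ∧
    ∃ F : (X →ᴬ[ℝ] X) → W, ContDiffOn ℝ ∞ F U ∧
      ∀ h : X ≃ᵢ X, isoToAffine h ∈ U → F (isoToAffine h) = f h

/-- Smoothness of a map from the orbit of `p`, as a submanifold of `X ^ S`, to a normed space: near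
every point of the orbit the map extends to a smooth map on an open subset of `X ^ S`. Smooth maps
on open subsets of `X ^ S` are those that locally are smooth functions of finitely many coordinates;
for finite `S` this is ordinary smoothness. (In general, if the points `p v`, `v` in a finite set
`T`, affinely span the same space as `p`, then the smooth structure is the one for which
restriction to `T` is a diffeomorphism to the orbit of `p` restricted to `T`.) -/
def IsSmoothOnOrbit {X : Type u} [NormedAddCommGroup X] [NormedSpace ℝ X] {S : Type v} {p : S → X}
    {W : Type w} [NormedAddCommGroup W] [NormedSpace ℝ W] (f : placementOrbit p → W) : Prop :=
  ∀ x : placementOrbit p, ∃ (T : Finset S) (U : Set (T → X)), IsOpen U ∧ T.restrict x.1 ∈ U ∧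
    ∃ F : (T → X) → W, ContDiffOn ℝ ∞ F U ∧
      ∀ y : placementOrbit p, T.restrict y.1 ∈ U → F (T.restrict y.1) = f y

/-- A placement `p` is isometrically full if `φ_p`, from `Iso(X)` to the orbit of `p`, is a smooth
diffeomorphism: it is a bijection `e`, it is smooth (coordinatewise, as a map to `X ^ S`), and its
inverse is smooth as a map to `Iso(X) ⊆ A(X)`. -/
def IsIsometricallyFull {X : Type u} [NormedAddCommGroup X] [NormedSpace ℝ X] {S : Type v}
    (p : S → X) : Prop :=
  ∃ e : (X ≃ᵢ X) ≃ placementOrbit p, (∀ g, e g = orbitMap p g) ∧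
    (∀ s : S, IsSmoothOnIso fun g => (e g).1 s) ∧
    IsSmoothOnOrbit fun y => isoToAffine (e.symm y)

/-! In a Euclidean space the reflection in the affine span of a placement fixes the placement, so
injectivity of `orbitMap` makes that span everything. Conversely, take an inner product `B`
invariant under all linear isometries. If each `B`-hyperplane is fixed pointwise by a nontrivial
linear isometry, this isometry must be the `B`-reflection; reflections act transitively on
`B`-spheres, so the norm is a multiple of that of `B`. If instead some hyperplane has only the
trivial pointwise fixer, the origin with a basis of it is a non-spanning placement. It is full: the
images of the basis determine that of the unit normal, and Gram-Schmidt recovers it smoothly, up to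
a sign that is locally constant by compactness. -/

open MeasureTheory in
/-- Every finite-dimensional real normed space carries an inner product that is invariant under all
linear isometries: average `f ⊗ f` over the dual unit ball. -/
theorem exists_invariant_inner (X : Type u) [NormedAddCommGroup X] [NormedSpace ℝ X]
    [FiniteDimensional ℝ X] :
    ∃ B : X →L[ℝ] X →L[ℝ] ℝ, (∀ x y, B x y = B y x) ∧ (∀ x, x ≠ 0 → 0 < B x x) ∧
      ∀ (T : X ≃ₗᵢ[ℝ] X) (x y : X), B (T x) (T y) = B x y := by
  -- Hausdorff measure is preserved by every isometry; in the top dimension it is also a Haar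
  -- measure, hence positive on nonempty open sets.
  let μ : Measure (X →L[ℝ] ℝ) := Measure.hausdorffMeasure (Module.finrank ℝ (X →L[ℝ] ℝ))
  have : μ.IsAddHaarMeasure := isAddHaarMeasure_hausdorffMeasure
  let K : Set (X →L[ℝ] ℝ) := Metric.closedBall 0 1
  have : ProperSpace (X →L[ℝ] ℝ) := FiniteDimensional.proper ℝ _
  have hK : IsCompact K := isCompact_closedBall 0 1
  have hint (x y : X) : Integrable (fun f : X →L[ℝ] ℝ => f x * f y) (μ.restrict K) :=
    ContinuousOn.integrableOn_compact hK (by fun_prop)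
  have hbil : IsBilinearMap ℝ fun x y : X => ∫ f in K, f x * f y ∂μ :=
    { add_left := fun x y z => by
        simp only [map_add, add_mul, integral_add (hint _ _) (hint _ _)]
      smul_left := fun c x y => by
        simp only [map_smul, smul_eq_mul, mul_assoc, integral_const_mul]
      add_right := fun x y z => by
        simp only [map_add, mul_add, integral_add (hint _ _) (hint _ _)]
      smul_right := fun c x y => by
        simp only [map_smul, smul_eq_mul, mul_left_comm _ c, integral_const_mul] }
  have happ (x y : X) : hbil.toContinuousBilinearMap x y = ∫ f in K, f x * f y ∂μ := rfl
  refine ⟨hbil.toContinuousBilinearMap, fun x y => ?_, fun x hx => ?_, fun T x y => ?_⟩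
  · simp only [happ, mul_comm]
  · have hcont : Continuous fun f : X →L[ℝ] ℝ => f x * f x := by fun_prop
    rw [happ, setIntegral_pos_iff_support_of_nonneg_ae
      (Filter.Eventually.of_forall fun f => mul_self_nonneg _)
      (hcont.continuousOn.integrableOn_compact hK)]
    have hopen : IsOpen (Function.support (fun f : X →L[ℝ] ℝ => f x * f x) ∩
        Metric.ball 0 1) := hcont.isOpen_support.inter Metric.isOpen_ball
    refine (hopen.measure_pos μ ?_).trans_le
      (measure_mono (Set.inter_subset_inter_right _ Metric.ball_subset_closedBall))
    obtain ⟨f, hf, hfx⟩ := exists_dual_vector ℝ x (by simpa using hx)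
    -- Halving the norming functional puts it in the open ball.
    refine ⟨(2⁻¹ : ℝ) • f, ?_, ?_⟩
    · simp [hfx, hx]
    · simp only [Metric.mem_ball, dist_zero_right, norm_smul, hf]
      norm_num
  · let Φ : (X →L[ℝ] ℝ) ≃ᵢ (X →L[ℝ] ℝ) :=
      { toFun := fun f => f.comp (T : X →L[ℝ] X)
        invFun := fun f => f.comp (T.symm : X →L[ℝ] X)
        left_inv := fun f => by ext; simp
        right_inv := fun f => by ext; simp
        isometry_toFun := Isometry.of_dist_eq fun f g => by
          rw [dist_eq_norm, dist_eq_norm, ← ContinuousLinearMap.sub_comp]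
          exact ContinuousLinearMap.opNorm_comp_linearIsometryEquiv _ _ }
    have hΦ (f : X →L[ℝ] ℝ) (x : X) : Φ f x = f (T x) := rfl
    have hmp : MeasurePreserving Φ μ μ := Φ.measurePreserving_hausdorffMeasure _
    have hpre : Φ ⁻¹' K = K := by
      ext f
      rw [Set.mem_preimage, mem_closedBall_zero_iff, mem_closedBall_zero_iff]
      exact iff_of_eq (congrArg (· ≤ 1)
        (ContinuousLinearMap.opNorm_comp_linearIsometryEquiv f T))
    have := hmp.setIntegral_preimage_emb Φ.toHomeomorph.measurableEmbedding
      (fun f => f x * f y) K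
    rw [hpre] at this
    simpa only [happ, hΦ] using this

/-- A unit vector for an inner product extends to an orthonormal basis. -/
theorem exists_orthonormal_complement {X : Type u} [AddCommGroup X] [Module ℝ X]
    [FiniteDimensional ℝ X] (c : InnerProductSpace.Core ℝ X) (w : X) (hw : c.inner w w = 1) :
    ∃ (k : ℕ) (b : Fin k → X), (∀ i, c.inner w (b i) = 0) ∧
      ∀ x, x = ∑ i, c.inner (b i) x • b i + c.inner w x • w := by
  let := c.toNormedAddCommGroup
  let : InnerProductSpace ℝ X := .ofCore c.toCore
  have hw' : inner ℝ w w = 1 := hw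
  have hn : ‖w‖ = 1 := by
    rw [real_inner_self_eq_norm_sq] at hw'
    nlinarith [norm_nonneg w]
  let b := stdOrthonormalBasis ℝ (ℝ ∙ w)ᗮ
  refine ⟨_, fun i => b i, fun i => ?_, fun x => ?_⟩
  · exact Submodule.mem_orthogonal_singleton_iff_inner_right.1 (b i).2
  · have hb (i) : inner ℝ (b i : X) w = 0 :=
      Submodule.mem_orthogonal_singleton_iff_inner_left.1 (b i).2
    have hy : x - inner ℝ w x • w ∈ (ℝ ∙ w)ᗮ := by
      rw [Submodule.mem_orthogonal_singleton_iff_inner_right, inner_sub_right, inner_smul_right,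
        hw', mul_one, sub_self]
    have h := congrArg Subtype.val (b.sum_repr' ⟨_, hy⟩)
    simp only [Submodule.coe_sum, Submodule.coe_smul, Submodule.coe_inner, inner_sub_right,
      inner_smul_right, hb, mul_zero, sub_zero] at h
    exact (sub_eq_iff_eq_add.1 h.symm)

/-- In a Euclidean space an isometrically full placement is spanning. -/
theorem IsIsometricallyFull.isSpanningPlacement_of_isEuclideanNormed {X : Type u}
    [NormedAddCommGroup X] [NormedSpace ℝ X] [FiniteDimensional ℝ X] (hX : IsEuclideanNormed X)
    {S : Type v} {p : S → X} (hS : ¬ (IsEmpty S ∧ Subsingleton X)) (hp : IsIsometricallyFull p) :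
    IsSpanningPlacement p := by
  obtain ⟨e, he, -, -⟩ := hp
  have hfix (g : X ≃ᵢ X) (hg : ∀ s, g (p s) = p s) (x : X) : g x = x := by
    have : g = IsometryEquiv.refl X := e.injective <| by
      rw [he, he]
      exact Subtype.ext (funext hg)
    rw [this]
    rfl
  rcases isEmpty_or_nonempty S with hE | hE
  -- Every translation fixes the empty placement, so all translations are trivial.
  · refine absurd ⟨hE, ⟨fun x y => ?_⟩⟩ hS
    have := hfix (IsometryEquiv.addRight (y - x)) (fun s => hE.elim s) x
    simpa [eq_comm] using this
  · obtain ⟨c, hc⟩ := hX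
    let _ : InnerProductSpace ℝ X :=
      { inner := c.inner
        norm_sq_eq_re_inner := hc
        conj_inner_symm := c.conj_inner_symm
        add_left := c.add_left
        smul_left := c.smul_left }
    have : Nonempty (affineSpan ℝ (Set.range p)) :=
      ⟨⟨_, mem_affineSpan ℝ (Set.mem_range_self (Classical.arbitrary S))⟩⟩
    refine SetLike.ext fun x => iff_of_true ?_ (AffineSubspace.mem_top ℝ X x)
    rw [← EuclideanGeometry.reflection_eq_self_iff (𝕜 := ℝ)]
    exact hfix (EuclideanGeometry.reflection (affineSpan ℝ (Set.range p))).toIsometryEquiv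
      (fun s => (EuclideanGeometry.reflection_eq_self_iff _).2
        (mem_affineSpan ℝ (Set.mem_range_self s))) x

/-! ### Enough reflections force a Euclidean norm -/

/-- If every hyperplane orthogonal, for an invariant inner product `B`, to a unit vector is fixed
pointwise by some nontrivial linear isometry, then the norm is a multiple of that of `B`. -/
theorem isEuclideanNormed_of_forall_exists_reflection {X : Type u}
    [NormedAddCommGroup X] [NormedSpace ℝ X] {B : X →L[ℝ] X →L[ℝ] ℝ}
    (hsymm : ∀ x y, B x y = B y x) (hpos : ∀ x, x ≠ 0 → 0 < B x x)
    (hinv : ∀ (T : X ≃ₗᵢ[ℝ] X) (x y : X), B (T x) (T y) = B x y)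
    (hrefl : ∀ w, B w w = 1 → ∃ T : X ≃ₗᵢ[ℝ] X, (∀ x, B w x = 0 → T x = x) ∧ T w ≠ w) :
    IsEuclideanNormed X := by
  have hdef (x : X) (hx : B x x = 0) : x = 0 := by
    by_contra h
    exact (hpos x h).ne' hx
  have hnn (x : X) : 0 ≤ B x x := by
    rcases eq_or_ne x 0 with rfl | h
    · simp
    · exact (hpos x h).le
  have hneg (w : X) (hw : B w w = 1) :
      ∃ T : X ≃ₗᵢ[ℝ] X, (∀ x, B w x = 0 → T x = x) ∧ T w = -w := by
    obtain ⟨T, hT, hTw⟩ := hrefl w hw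
    refine ⟨T, hT, ?_⟩
    -- `T` preserves `B` and fixes the hyperplane, so `T w` is normal to it and has the `B`-length
    -- of `w`: only `w` and `-w` remain.
    have horth (h : X) (hh : B w h = 0) : B (T w) h = 0 := by
      rw [← hh, ← hinv T w h, hT h hh]
    have hu : B w (T w - B w (T w) • w) = 0 := by simp [hw]
    have hTw' : T w = B w (T w) • w := by
      refine sub_eq_zero.1 (hdef _ ?_)
      have h := horth _ hu
      rw [map_sub B, sub_apply, h, map_smul B, smul_apply, hu, smul_zero, sub_zero]
    have hsq : B w (T w) * B w (T w) = 1 := by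
      have h := hinv T w w
      rw [hTw', hw] at h
      simpa [hw] using h
    rcases mul_self_eq_one_iff.1 hsq with h | h
    · rw [h, one_smul] at hTw'
      exact absurd hTw' hTw
    · rw [hTw', h, neg_one_smul]
  have hconst (x y : X) (hxy : B x x = B y y) : ‖x‖ = ‖y‖ := by
    rcases eq_or_ne x y with rfl | hne
    · rfl
    have hz : 0 < B (x - y) (x - y) := hpos _ (sub_ne_zero.2 hne)
    set r := Real.sqrt (B (x - y) (x - y)) with hr
    have hr0 : 0 < r := Real.sqrt_pos.2 hz
    have hr2 : r * r = B (x - y) (x - y) := Real.mul_self_sqrt hz.le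
    -- The reflection along `x - y` swaps `x` and `y`, since `x + y` is orthogonal to `x - y`.
    obtain ⟨T, hT, hTw⟩ := hneg (r⁻¹ • (x - y)) (by
      rw [map_smul, map_smul, smul_apply, ← hr2, smul_eq_mul, smul_eq_mul]
      field_simp)
    have h1 : T (x - y) = -(x - y) := by
      rw [map_smul, ← smul_neg] at hTw
      exact smul_right_injective X (inv_ne_zero hr0.ne') hTw
    have h2 : T (x + y) = x + y := hT _ (by
      simp only [map_smul, smul_apply, map_add, map_sub,
        sub_apply, hxy, hsymm y x, smul_eq_mul]
      ring)
    have h3 : T x = y := by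
      have h4 : (2 : ℝ) • T x = (2 : ℝ) • y := by
        rw [← map_smul, show (2 : ℝ) • x = (x + y) + (x - y) by rw [two_smul]; abel, map_add, h1,
          h2, two_smul]
        abel
      exact smul_right_injective X two_ne_zero h4
    rw [← h3, T.norm_map]
  rcases subsingleton_or_nontrivial X with hX | hX
  · exact ⟨⟨⟨⟨fun x y => B x y⟩, fun x y => hsymm y x, fun x => hnn x, fun x y z => by simp,
      fun x y r => by simp⟩, fun x hx => hdef x hx⟩, fun x => by
        rw [Subsingleton.elim x 0]
        change _ = B 0 0
        simp⟩
  obtain ⟨a, ha⟩ := exists_ne (0 : X)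
  have haB := hpos a ha
  have hk : 0 < ‖a‖ ^ 2 / B a a := by positivity
  refine ⟨⟨⟨⟨fun x y => ‖a‖ ^ 2 / B a a * B x y⟩, fun x y => by simp [hsymm y x],
    fun x => mul_nonneg hk.le (hnn x), fun x y z => by simp [mul_add],
    fun x y r => by simp [mul_left_comm]⟩,
    fun x hx => hdef x ((mul_eq_zero.1 hx).resolve_left hk.ne')⟩, fun x => ?_⟩
  have ht : 0 ≤ B x x / B a a := div_nonneg (hnn x) haB.le
  have h := hconst x (Real.sqrt (B x x / B a a) • a) (by
    rw [map_smul, map_smul, smul_apply, smul_eq_mul, smul_eq_mul, ← mul_assoc,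
      Real.mul_self_sqrt ht]
    field_simp)
  rw [h, norm_smul, mul_pow, Real.norm_eq_abs, sq_abs, Real.sq_sqrt ht]
  change _ = ‖a‖ ^ 2 / B a a * B x x
  ring

/-! ### Linear parts and the smooth inverse -/

section LinearPart

variable {X : Type u} [NormedAddCommGroup X] [NormedSpace ℝ X]

/-- The linear part of an isometry of a real normed space. -/
noncomputable def isoLinear (g : X ≃ᵢ X) : X ≃ₗᵢ[ℝ] X :=
  g.toRealAffineIsometryEquiv.linearIsometryEquiv

theorem isoLinear_apply_sub (g : X ≃ᵢ X) (x y : X) : isoLinear g (x - y) = g x - g y :=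
  g.toRealAffineIsometryEquiv.map_vsub x y

theorem isoLinear_apply (g : X ≃ᵢ X) (x : X) : isoLinear g x = g x - g 0 := by
  rw [← isoLinear_apply_sub, sub_zero]

theorem decomp_isoToAffine (g : X ≃ᵢ X) :
    ContinuousAffineMap.decompLinearIsometryEquiv ℝ ℝ X X (isoToAffine g) =
      (g 0, ((isoLinear g).toContinuousLinearEquiv : X →L[ℝ] X)) := rfl

theorem isSmoothOnIso_apply (x : X) : IsSmoothOnIso fun g : X ≃ᵢ X => g x := by
  refine fun g => ⟨Set.univ, isOpen_univ, trivial, fun f =>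
    (ContinuousAffineMap.decompLinearIsometryEquiv ℝ ℝ X X f).2 x +
      (ContinuousAffineMap.decompLinearIsometryEquiv ℝ ℝ X X f).1,
      ContDiff.contDiffOn ?_, fun h _ => ?_⟩
  · have h := (ContinuousAffineMap.decompLinearIsometryEquiv ℝ ℝ X X).contDiff (n := ∞)
    exact (h.snd.clm_apply contDiff_const).add h.fst
  · simp only [decomp_isoToAffine]
    change isoLinear h x + h 0 = h x
    rw [isoLinear_apply, sub_add_cancel]

/-- The linear isometries whose value at `w` lies in a closed half space and whose values at the
`b i` are prescribed cover a closed set of values. -/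
theorem isClosed_image_isometries [FiniteDimensional ℝ X] {k : ℕ} (b : Fin k → X) (w : X)
    (l : X →L[ℝ] ℝ) :
    IsClosed ((fun (A : X →L[ℝ] X) i => A (b i)) ''
      {A : X →L[ℝ] X | (∀ x, ‖A x‖ = ‖x‖) ∧ l (A w) ≤ 0}) := by
  have : ProperSpace (X →L[ℝ] X) := FiniteDimensional.proper ℝ _
  refine (IsCompact.image (Metric.isCompact_of_isClosed_isBounded ?_ ?_) ?_).isClosed
  · rw [Set.ofPred_and, Set.ofPred_forall]
    refine (isClosed_iInter fun x => isClosed_eq ?_ continuous_const).inter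
      (isClosed_le ?_ continuous_const) <;> fun_prop
  · refine (Metric.isBounded_closedBall (x := 0) (r := 1)).subset fun A hA => ?_
    rw [mem_closedBall_zero_iff]
    exact A.opNorm_le_bound zero_le_one fun x => by rw [hA.1, one_mul]
  · fun_prop

end LinearPart

/-- The explicit smooth inverse of the orbit map: `a` extends to `X` by sending the unit normal `w`
of the hyperplane to the normalised component of `n` orthogonal to the vectors `a i`. -/
noncomputable def normalExtension {X : Type u} [NormedAddCommGroup X] [NormedSpace ℝ X]
    (B : X →L[ℝ] X →L[ℝ] ℝ) {k : ℕ} (b : Fin k → X) (w n : X) (a : Fin k → X) : X →L[ℝ] X :=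
  ∑ i, ContinuousLinearMap.smulRightL ℝ X X (B (b i)) (a i) +
    ContinuousLinearMap.smulRightL ℝ X X (B w)
      ((Real.sqrt (B n (n - ∑ i, B n (a i) • a i)))⁻¹ • (n - ∑ i, B n (a i) • a i))

section NormalExtension

variable {X : Type u} [NormedAddCommGroup X] [NormedSpace ℝ X] {B : X →L[ℝ] X →L[ℝ] ℝ} {k : ℕ}
  {b : Fin k → X} {w : X}

theorem contDiffOn_normalExtension (B : X →L[ℝ] X →L[ℝ] ℝ) (b : Fin k → X) (w n : X) :
    ContDiffOn ℝ ∞ (normalExtension B b w n) {a | 0 < B n (n - ∑ i, B n (a i) • a i)} := by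
  have hN : ContDiff ℝ ∞ fun a : Fin k → X => n - ∑ i, B n (a i) • a i := by fun_prop
  have hsqrt : ContDiffOn ℝ ∞ (fun a : Fin k → X =>
      (Real.sqrt (B n (n - ∑ i, B n (a i) • a i)))⁻¹) {a | 0 < B n (n - ∑ i, B n (a i) • a i)} :=
    (((B n).contDiff.comp hN).contDiffOn.sqrt fun a ha => ne_of_gt ha).inv
      fun a ha => (Real.sqrt_pos.2 ha).ne'
  refine ContDiffOn.add (ContDiff.contDiffOn ?_) ?_
  · fun_prop
  · exact (ContinuousLinearMap.contDiff _).comp_contDiffOn (hsqrt.smul hN.contDiffOn)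

/-- The vectors `T (b i)` and `T w` again give an orthonormal expansion, so only the `T w` component
of `n` survives. -/
theorem sub_sum_inner_smul_isometry
    (hinv : ∀ (T : X ≃ₗᵢ[ℝ] X) (x y : X), B (T x) (T y) = B x y)
    (hsymm : ∀ x y, B x y = B y x)
    (hexp : ∀ x, x = ∑ i, B (b i) x • b i + B w x • w) (T : X ≃ₗᵢ[ℝ] X) (n : X) :
    n - ∑ i, B n (T (b i)) • T (b i) = B n (T w) • T w := by
  obtain ⟨m, rfl⟩ := T.surjective n
  simp only [hinv]
  conv_lhs => enter [1]; rw [hexp m]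
  simp [hsymm m]

/-- The square root in `normalExtension` is `|B n (T w)|`; positivity selects `T w` rather than `-T
w`. -/
theorem normalExtension_isometry
    (hinv : ∀ (T : X ≃ₗᵢ[ℝ] X) (x y : X), B (T x) (T y) = B x y)
    (hsymm : ∀ x y, B x y = B y x)
    (hexp : ∀ x, x = ∑ i, B (b i) x • b i + B w x • w) (T : X ≃ₗᵢ[ℝ] X) {n : X}
    (hn : 0 < B n (T w)) :
    normalExtension B b w n (fun i => T (b i)) = (T.toContinuousLinearEquiv : X →L[ℝ] X) := by
  ext x
  rw [normalExtension, sub_sum_inner_smul_isometry hinv hsymm hexp, map_smul (B n), smul_eq_mul,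
    Real.sqrt_mul_self hn.le, inv_smul_smul₀ hn.ne']
  change _ = T x
  conv_rhs => rw [hexp x]
  simp

end NormalExtension

/-! ### A full placement that is not spanning -/

/-- The placement of the origin together with the vectors `b i`. -/
def originPlacement {X : Type u} [Zero X] {k : ℕ} (b : Fin k → X) :
    ULift.{v} (Option (Fin k)) → X :=
  fun s => s.down.elim 0 b

/-- If only the identity linear isometry fixes the hyperplane spanned by the `b i` pointwise, then
the placement consisting of the origin and the `b i` is isometrically full. -/
theorem isIsometricallyFull_originPlacement {X : Type u} [NormedAddCommGroup X] [NormedSpace ℝ X]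
    [FiniteDimensional ℝ X] {B : X →L[ℝ] X →L[ℝ] ℝ} {k : ℕ} {b : Fin k → X} {w : X}
    (hinv : ∀ (T : X ≃ₗᵢ[ℝ] X) (x y : X), B (T x) (T y) = B x y)
    (hsymm : ∀ x y, B x y = B y x) (hw : B w w = 1)
    (hexp : ∀ x, x = ∑ i, B (b i) x • b i + B w x • w)
    (hfix : ∀ T : X ≃ₗᵢ[ℝ] X, (∀ i, T (b i) = b i) → T w = w) :
    IsIsometricallyFull (originPlacement.{u, v} b) := by
  have hagree (T T' : X ≃ₗᵢ[ℝ] X) (h : ∀ i, T (b i) = T' (b i)) : T w = T' w := by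
    have := hfix (T.trans T'.symm) fun i => by simp [h]
    simpa using congrArg T' this
  have hdiff (g : X ≃ᵢ X) (i : Fin k) : isoLinear g (b i) =
      isoAct g (originPlacement.{u, v} b) ⟨some i⟩ -
        isoAct g (originPlacement.{u, v} b) ⟨none⟩ := isoLinear_apply g (b i)
  have hinj : Function.Injective (orbitMap (originPlacement.{u, v} b)) := by
    intro g g' h
    have h' : isoAct g (originPlacement.{u, v} b) = isoAct g' (originPlacement.{u, v} b) :=
      congrArg Subtype.val h
    have h0 : g 0 = g' 0 := congrFun h' ⟨none⟩
    have hb (i) : isoLinear g (b i) = isoLinear g' (b i) := by rw [hdiff, hdiff, h']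
    ext x
    have : isoLinear g x = isoLinear g' x := by
      rw [hexp x]
      simp [hb, hagree _ _ hb]
    rwa [isoLinear_apply, isoLinear_apply, h0, sub_left_inj] at this
  have hsurj : Function.Surjective (orbitMap (originPlacement.{u, v} b)) := by
    rintro ⟨_, g, rfl⟩
    exact ⟨g, rfl⟩
  let e := Equiv.ofBijective _ ⟨hinj, hsurj⟩
  refine ⟨e, fun g => rfl, fun s => isSmoothOnIso_apply _, fun x => ?_⟩
  obtain ⟨g, rfl⟩ := e.surjective x
  let S := ULift.{v} (Option (Fin k))
  let a (y : ↥(Finset.univ : Finset S) → X) (i : Fin k) : X :=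
    y ⟨⟨some i⟩, Finset.mem_univ _⟩ - y ⟨⟨none⟩, Finset.mem_univ _⟩
  have ha : ContDiff ℝ ∞ a := by fun_prop
  have hag (h : X ≃ᵢ X) : a (Finset.univ.restrict (e h).1) = fun i => isoLinear h (b i) :=
    funext fun i => (hdiff h i).symm
  let n : X := isoLinear g w
  -- `K` collects the values on `b` of isometries sending `w` to the wrong side. It is closed and,
  -- by `hagree`, misses the value of `g`, so its complement fixes the sign; `V` keeps the square
  -- root smooth.
  let K : Set (Fin k → X) := (fun (A : X →L[ℝ] X) i => A (b i)) ''
      {A : X →L[ℝ] X | (∀ x, ‖A x‖ = ‖x‖) ∧ B n (A w) ≤ 0}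
  let V : Set (Fin k → X) := {c | 0 < B n (n - ∑ i, B n (c i) • c i)}
  have hV : IsOpen V := isOpen_lt continuous_const (by fun_prop)
  have hnw : B n (isoLinear g w) = 1 := (hinv _ _ _).trans hw
  have hpos (h : X ≃ᵢ X) (hh : (fun i => isoLinear h (b i)) ∉ K) : 0 < B n (isoLinear h w) := by
    by_contra! hle
    exact hh ⟨((isoLinear h).toContinuousLinearEquiv : X →L[ℝ] X),
      ⟨(isoLinear h).norm_map, hle⟩, rfl⟩
  refine ⟨Finset.univ, a ⁻¹' (Kᶜ ∩ V),
    ((isClosed_image_isometries b w (B n)).isOpen_compl.inter hV).preimage ha.continuous, ?_,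
    fun y => (ContinuousAffineMap.decompLinearIsometryEquiv ℝ ℝ X X).symm
      (y ⟨⟨none⟩, Finset.mem_univ _⟩, normalExtension B b w n (a y)), ?_, fun y hy => ?_⟩
  · rw [Set.mem_preimage, hag]
    constructor
    · rintro ⟨A, ⟨hA, hAw⟩, hAb⟩
      let A' : X ≃ₗᵢ[ℝ] X := LinearIsometry.toLinearIsometryEquiv ⟨A.toLinearMap, hA⟩ rfl
      have : A w = isoLinear g w := hagree A' (isoLinear g) (congrFun hAb)
      rw [this, hnw] at hAw
      exact absurd hAw (by norm_num)
    · change 0 < B n (n - _)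
      rw [sub_sum_inner_smul_isometry hinv hsymm hexp, hnw, one_smul, hnw]
      exact one_pos
  · refine (ContinuousAffineMap.decompLinearIsometryEquiv ℝ ℝ X X).symm.contDiff.comp_contDiffOn
      (ContDiffOn.prodMk (ContDiff.contDiffOn (by fun_prop)) ?_)
    exact (contDiffOn_normalExtension B b w n).comp ha.contDiffOn fun y hy => hy.2
  · obtain ⟨h, rfl⟩ := e.surjective y
    rw [Set.mem_preimage, hag] at hy
    beta_reduce
    rw [hag, normalExtension_isometry hinv hsymm hexp _ (hpos h hy.1), Equiv.symm_apply_apply,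
      LinearIsometryEquiv.symm_apply_eq, decomp_isoToAffine]
    rfl

/-- The placement of the origin and vectors orthogonal to `w` is not spanning. -/
theorem not_isSpanningPlacement_originPlacement {X : Type u} [NormedAddCommGroup X]
    [NormedSpace ℝ X] {l : X →L[ℝ] ℝ} {k : ℕ} {b : Fin k → X} (hb : ∀ i, l (b i) = 0)
    (hl : l ≠ 0) : ¬ IsSpanningPlacement (originPlacement.{u, v} b) := by
  intro h
  refine hl (ContinuousLinearMap.ext fun x => ?_)
  have hle : affineSpan ℝ (Set.range (originPlacement.{u, v} b)) ≤
      (LinearMap.ker l.toLinearMap).toAffineSubspace := by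
    refine affineSpan_le.2 ?_
    rintro _ ⟨⟨_ | i⟩, rfl⟩
    · exact map_zero l
    · exact hb i
  rw [show affineSpan ℝ _ = ⊤ from h] at hle
  exact hle (AffineSubspace.mem_top ℝ X x)

/-- A finite-dimensional real normed space is Euclidean if and only if all its isometrically full
placements are spanning (leaving out the placement of the empty set in the zero space). -/
theorem mainTheorem8 {X : Type u} [NormedAddCommGroup X] [NormedSpace ℝ X]
    [FiniteDimensional ℝ X] :
    (∀ (S : Type v) (p : S → X), ¬ (IsEmpty S ∧ Subsingleton X) →
      IsIsometricallyFull p → IsSpanningPlacement p) ↔ IsEuclideanNormed X := by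
  refine ⟨fun hX => ?_, fun hX S p hS hp => hp.isSpanningPlacement_of_isEuclideanNormed hX hS⟩
  obtain ⟨B, hsymm, hpos, hinv⟩ := exists_invariant_inner X
  refine isEuclideanNormed_of_forall_exists_reflection hsymm hpos hinv fun w hw => ?_
  let c : InnerProductSpace.Core ℝ X :=
    { inner := fun x y => B x y
      conj_inner_symm := fun x y => hsymm y x
      re_inner_nonneg := fun x => by
        rcases eq_or_ne x 0 with rfl | h
        · simp
        · exact (hpos x h).le
      add_left := fun x y z => by simp
      smul_left := fun x y r => by simp
      definite := fun x hx => by_contra fun h => (hpos x h).ne' hx }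
  obtain ⟨k, b, hwb, hexp⟩ := exists_orthonormal_complement c w hw
  by_contra! hT
  refine not_isSpanningPlacement_originPlacement.{u, v} (l := B w) hwb ?_ (hX _ _ ?_
    (isIsometricallyFull_originPlacement hinv hsymm hw hexp fun T hTb => hT T fun x hx => ?_))
  · intro h
    simp [h] at hw
  · exact fun h => h.1.elim ⟨none⟩
  · have h := hexp x
    rw [show c.inner w x = 0 from hx, zero_smul, add_zero] at h
    rw [h]
    simp [hTb]
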